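/- Let $A\in\mathbb R^{n\times n}$ be row-stochastic, irreducible and aperiodic, let $\mathcal S\subseteq\{1,\dots,n\}$ be a non-empty set of source nodes, and let $B$ be the matrix whose columns are the $0$–$1$ indicator vectors of the nodes in $\mathcal S$. Consider the model $\mathbf x[k+1]=A\mathbf x[k]+B\mathbf u[k]$, $\mathbf x[0]=0$, with controllability Gramian $W(k_f)=\sum_{i=0}^{k_f-1}(A^iB)(A^iB)^T$, and for a non-empty set $\mathcal B$ of nodes let $W(\mathcal B,k_f)$ be the principal submatrix of $W(k_f)$ with rows and columns in $\mathcal B$. Then $A$ has a unique left eigenvector $w$ for the eigenvalue $1$ with entries summing to $1$, its entries are positive, and the following hold. 1. For every non-empty $\mathcal B$, $Q=W(\mathcal B,k_f)$ can be written as $Q=\bigl(k_f\sum_{i\in\mathcal S}w_i^2\bigr)\mathbf 1\mathbf 1^T+H(k_f)$, where the entries of $H(k_f)$ are bounded in absolute value by a constant independent of $k_f$. 2. The dominant eigenvalue of $Q$ is $\lambda_{\max}(Q)=|\mathcal B|\,k_f\sum_{i\in\mathcal S}w_i^2+\widehat\lambda(k_f)$, where $|\widehat\lambda(k_f)|$ is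 bounded by a constant independent of $k_f$. There are vectors $\mathbf c(k_f)$, with every entry tending to $0$ as $k_f\to\infty$, such that $\mathbf 1+\mathbf c(k_f)$ is an eigenvector of $Q$ for $\lambda_{\max}(Q)$; for all sufficiently large $k_f$ it is the only one up to scaling. 3. Let $\mathcal T$ be a non-empty set of $p$ target nodes, and let $\mathbf y[k]$ be the vector of the states of the nodes in $\mathcal T$. The model is target controllable over $[0,k_f]$ if every goal $\overline{\mathbf y}\in\mathbb R^p$ is equal to $\mathbf y[k_f]$ for some input; then the target-control energy $E(k_f,\overline{\mathbf y})$ is the minimum of $\sum_{i=0}^{k_f-1}\mathbf u[i]^T\mathbf u[i]$ over the inputs with $\mathbf y[k_f]=\overline{\mathbf y}$, the target security is $E_{\min}(k_f)=\min_{\|\overline{\mathbf y}\|_2=1}E(k_f,\overline{\mathbf y})$, and a minimally secure goal is a unit vector $\overline{\mathbf y}$ that attains it. All these minima exist whenever the model is target controllable over $[0,k_f]$. There are numbers $\widehat E(k_f)$ tending to $0$ as $k_f\to\infty$ such that, for every $k_f$ for which the model is target controllable over $[0,k_f]$, $$E_{\min}(k_f)=\frac1{p\,k_f\sum_{i\in\mathcal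 S}w_i^2}+\widehat E(k_f).$$ Moreover, there are vectors $\mathbf c(k_f)$, with every entry tending to $0$ as $k_f\to\infty$, such that for each such $k_f$ the vector $\mathbf 1+\mathbf c(k_f)$, rescaled to unit Euclidean norm, is a minimally secure goal; for all sufficiently large such $k_f$ it is the only one up to sign. -/

import Mathlib

open Matrix Filter Topology

noncomputable section

namespace NetworkConsensus

variable {n : ℕ}

/-- A nonnegative square matrix is aperiodic if, at every node `i`, the greatest common divisor
of the lengths `k` of the closed walks through `i` (those with `(A ^ k) i i > 0`) is `1`. -/
def IsAperiodic (A : Matrix (Fin n) (Fin n) ℝ) : Prop :=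
  ∀ i, ∀ d : ℕ, (∀ k : ℕ, 0 < k → 0 < (A ^ k) i i → d ∣ k) → d = 1

/-- The state matrix of the network-consensus model: row-stochastic, irreducible, aperiodic. -/
structure IsConsensusMatrix (A : Matrix (Fin n) (Fin n) ℝ) : Prop where
  stochastic : A ∈ Matrix.rowStochastic ℝ (Fin n)
  irreducible : A.IsIrreducible
  aperiodic : IsAperiodic A

/-- `w` is a left eigenvector of `A` for the eigenvalue `1`, with entries summing to `1`. -/
def IsNormalizedLeftEigenvector (A : Matrix (Fin n) (Fin n) ℝ) (w : Fin n → ℝ) : Prop :=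
  w ᵥ* A = w ∧ ∑ i, w i = 1

/-- The input matrix: its columns are the `0`-`1` indicators of the source nodes. -/
def inputMatrix (S : Finset (Fin n)) : Matrix (Fin n) S ℝ :=
  Matrix.of fun i s => if i = (s : Fin n) then 1 else 0

/-- The output matrix: its rows are the `0`-`1` indicators of the target nodes. -/
def outputMatrix (T : Finset (Fin n)) : Matrix T (Fin n) ℝ :=
  Matrix.of fun t i => if i = (t : Fin n) then 1 else 0

/-- The state trajectory `x[k+1] = A x[k] + B u[k]` from the relaxed initial state `x[0] = 0`. -/
def state (A : Matrix (Fin n) (Fin n) ℝ) (S : Finset (Fin n)) (u : ℕ → S → ℝ) :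
    ℕ → Fin n → ℝ
  | 0 => 0
  | k + 1 => A *ᵥ state A S u k + inputMatrix S *ᵥ u k

/-- The target state `y[k] = C x[k]`. -/
def targetState (A : Matrix (Fin n) (Fin n) ℝ) (S T : Finset (Fin n)) (u : ℕ → S → ℝ) (k : ℕ) :
    T → ℝ :=
  outputMatrix T *ᵥ state A S u k

/-- Every goal can be reached at time `kf` from the relaxed initial state. -/
def TargetControllable (A : Matrix (Fin n) (Fin n) ℝ) (S T : Finset (Fin n)) (kf : ℕ) : Prop :=
  ∀ y : T → ℝ, ∃ u : ℕ → S → ℝ, targetState A S T u kf = y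

/-- The energy of the input samples `u[0], …, u[kf-1]`. -/
def inputEnergy {S : Finset (Fin n)} (kf : ℕ) (u : ℕ → S → ℝ) : ℝ :=
  ∑ i ∈ Finset.range kf, u i ⬝ᵥ u i

/-- `e` is the target-control energy of the goal `y` over `[0, kf]`: the minimum of the energies
of the inputs that drive the relaxed model to the target state `y` at time `kf`. -/
def IsTargetControlEnergy (A : Matrix (Fin n) (Fin n) ℝ) (S T : Finset (Fin n)) (kf : ℕ)
    (y : T → ℝ) (e : ℝ) : Prop :=
  IsLeast {r : ℝ | ∃ u : ℕ → S → ℝ, targetState A S T u kf = y ∧ inputEnergy kf u = r} e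

/-- `E` is the target security over `[0, kf]`: the minimum of the target-control energy over
the goals of unit Euclidean norm. -/
def IsTargetSecurity (A : Matrix (Fin n) (Fin n) ℝ) (S T : Finset (Fin n)) (kf : ℕ)
    (E : ℝ) : Prop :=
  IsLeast {e : ℝ | ∃ y : T → ℝ, y ⬝ᵥ y = 1 ∧ IsTargetControlEnergy A S T kf y e} E

/-- `y` is a minimally secure goal: a goal of unit Euclidean norm whose target-control energy
is the target security. -/
def IsMinimallySecureGoal (A : Matrix (Fin n) (Fin n) ℝ) (S T : Finset (Fin n)) (kf : ℕ)
    (y : T → ℝ) : Prop :=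
  y ⬝ᵥ y = 1 ∧ ∃ E : ℝ, IsTargetSecurity A S T kf E ∧ IsTargetControlEnergy A S T kf y E

/-- The controllability Gramian `W(kf) = ∑_{i < kf} (Aⁱ B)(Aⁱ B)ᵀ`. -/
def gramian (A : Matrix (Fin n) (Fin n) ℝ) (S : Finset (Fin n)) (kf : ℕ) :
    Matrix (Fin n) (Fin n) ℝ :=
  ∑ i ∈ Finset.range kf, (A ^ i * inputMatrix S) * (A ^ i * inputMatrix S)ᵀ

/-- The principal submatrix `W(𝓑, kf)` of the Gramian. -/
def gramianSub (A : Matrix (Fin n) (Fin n) ℝ) (S B : Finset (Fin n)) (kf : ℕ) :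
    Matrix B B ℝ :=
  (gramian A S kf).submatrix (fun b => (b : Fin n)) (fun b => (b : Fin n))

/-- `μ` is the dominant eigenvalue of the (real symmetric) matrix `M`: the largest eigenvalue,
and larger in magnitude than every other one. -/
def IsDominantEigenvalue {ι : Type*} [Fintype ι] [DecidableEq ι] (M : Matrix ι ι ℝ)
    (μ : ℝ) : Prop :=
  IsGreatest {ν : ℝ | Module.End.HasEigenvalue (Matrix.toLin' M) ν} μ ∧
    ∀ ν : ℝ, Module.End.HasEigenvalue (Matrix.toLin' M) ν → ν ≠ μ → |ν| < |μ|

/-- The rescaling of a vector to unit Euclidean norm. -/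
def unitize {ι : Type*} [Fintype ι] (v : ι → ℝ) : ι → ℝ :=
  (√(v ⬝ᵥ v))⁻¹ • v

end NetworkConsensus

end

open NetworkConsensus

/-! Some power of `A` has positive entries, so it dominates `δ 1 wᵀ` for some `δ > 0`. This makes `A
^ k - 1 wᵀ` contract every `m` steps, with summable entrywise errors (`exists_sum_abs_pow_sub_le`).
Hence each summand of a Gramian block is `(∑ wᵢ²) 1 1ᵀ` up to a summable error, and the block is `a
1 1ᵀ + H` with `a = kf ∑ wᵢ²` and `H` bounded (`abs_gramianSub_sub_le`).

For such a matrix, two rows of the equation `M v = μ v` differ only through `H`, so the entries of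
`v` differ by at most a constant times `max |vᵢ| / μ`. The top eigenvalue is `card * a` up to a
bounded error and tends to infinity. Its eigenvectors therefore approach multiples of `1`, and its
eigenspace is eventually a line (`exists_dominant_eigenpairs`).

On the control side, the least energy reaching `Q z` is `zᵀ Q z`, attained by the adjoint input.
Target controllability makes `Q` definite, so every goal has this form. Over unit goals the minimum
is `1 / μ`, attained exactly at the unit eigenvectors for the top eigenvalue `μ`
(`isMinimallySecureGoal_iff`). Claim 3 is then claim 2 read through reciprocals. -/

namespace NetworkConsensus

/-! ### Powers of a primitive row-stochastic matrix -/

variable {n : ℕ}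

/-- At every node of an aperiodic nonnegative matrix, all sufficiently long return times occur. -/
theorem IsAperiodic.exists_forall_ge_pow_pos {A : Matrix (Fin n) (Fin n) ℝ}
    (h0 : ∀ i j, 0 ≤ A i j) (hA : IsAperiodic A) (i : Fin n) :
    ∃ N : ℕ, ∀ k ≥ N, 0 < (A ^ k) i i := by
  have hpow : ∀ k i j, 0 ≤ (A ^ k) i j := fun k => Matrix.pow_apply_nonneg h0 k
  set R : Set ℕ := {k | 0 < k ∧ 0 < (A ^ k) i i} with hR
  have hg : Nat.setGcd R = 1 :=
    hA i _ fun k hk hk' => Nat.setGcd_dvd_of_mem (show k ∈ R from ⟨hk, hk'⟩)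
  -- All large multiples of the gcd, here `1`, are sums of return times. Concatenating closed walks
  -- shows that such sums again have a positive diagonal entry.
  obtain ⟨N, hN⟩ := Nat.exists_mem_closure_of_ge R
  refine ⟨N, fun k hk => ?_⟩
  refine AddSubmonoid.closure_induction (motive := fun k _ => 0 < (A ^ k) i i)
    (fun k hk => hk.2) (by simp) (fun a b _ _ ha hb => ?_) (hN k hk (by simp [hg]))
  rw [pow_add, Matrix.mul_apply]
  exact Finset.sum_pos' (fun l _ => mul_nonneg (hpow _ _ _) (hpow _ _ _))
    ⟨i, Finset.mem_univ _, mul_pos ha hb⟩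

/-- An irreducible aperiodic matrix is primitive: some power has positive entries. -/
theorem IsConsensusMatrix.exists_pow_pos {A : Matrix (Fin n) (Fin n) ℝ}
    (hA : IsConsensusMatrix A) : ∃ m : ℕ, ∀ i j, 0 < (A ^ m) i j := by
  have h0 : ∀ i j, 0 ≤ A i j := hA.stochastic.1
  have hpow : ∀ k i j, 0 ≤ (A ^ k) i j := fun k => Matrix.pow_apply_nonneg h0 k
  have hij : ∀ p : Fin n × Fin n, ∃ N : ℕ, ∀ k ≥ N, 0 < (A ^ k) p.1 p.2 := by
    rintro ⟨i, j⟩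
    obtain ⟨N, hN⟩ := hA.aperiodic.exists_forall_ge_pow_pos h0 i
    -- A closed walk at `i` of any length at least `N`, followed by a fixed walk of length `l` to
    -- `j`.
    obtain ⟨l, -, hl⟩ := (Matrix.isIrreducible_iff_exists_pow_pos h0).1 hA.irreducible i j
    refine ⟨N + l, fun k hk => ?_⟩
    obtain ⟨r, rfl⟩ := Nat.exists_eq_add_of_le' (le_of_add_le_right hk)
    rw [pow_add, Matrix.mul_apply]
    exact Finset.sum_pos' (fun l _ => mul_nonneg (hpow _ _ _) (hpow _ _ _))
      ⟨i, Finset.mem_univ _, mul_pos (hN r (by lia)) hl⟩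
  choose N hN using hij
  exact ⟨Finset.univ.sup N, fun i j => hN (i, j) _ (Finset.le_sup (Finset.mem_univ (i, j)))⟩

theorem vecMul_pow_of_vecMul_eq {A : Matrix (Fin n) (Fin n) ℝ} {v : Fin n → ℝ}
    (h : v ᵥ* A = v) (k : ℕ) : v ᵥ* A ^ k = v := by
  induction k with
  | zero => simp
  | succ k ih => rw [pow_succ, ← Matrix.vecMul_vecMul, ih, h]

/-- A row-stochastic matrix with a positive power has a positive normalized left eigenvector. -/
theorem exists_pos_isNormalizedLeftEigenvector [NeZero n] {A : Matrix (Fin n) (Fin n) ℝ}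
    (hA : A ∈ Matrix.rowStochastic ℝ (Fin n)) {m : ℕ} (hm : ∀ i j, 0 < (A ^ m) i j) :
    ∃ w : Fin n → ℝ, IsNormalizedLeftEigenvector A w ∧ ∀ i, 0 < w i := by
  have hone : (A - 1) *ᵥ (1 : Fin n → ℝ) = 0 := by rw [Matrix.sub_mulVec, hA.2]; simp
  have hdet : (A - 1).det = 0 := Matrix.exists_mulVec_eq_zero_iff.1 ⟨1, one_ne_zero, hone⟩
  obtain ⟨v, hv, hvA⟩ := Matrix.exists_vecMul_eq_zero_iff.2 hdet
  rw [Matrix.vecMul_sub, Matrix.vecMul_one, sub_eq_zero] at hvA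
  -- The sign of `v` is unknown. The triangle inequality gives `|v| ≤ |v| A` entrywise; both sides
  -- have the same total since the rows of `A` sum to `1`, so equality holds in every entry.
  have hle : ∀ j, |v j| ≤ ∑ i, |v i| * A i j := fun j => by
    conv_lhs => rw [← hvA]
    change |∑ i, v i * A i j| ≤ _
    refine (Finset.abs_sum_le_sum_abs _ _).trans_eq
      (Finset.sum_congr rfl fun i _ => ?_)
    rw [abs_mul, abs_of_nonneg (hA.1 i j)]
  have hsum : ∑ j, |v j| = ∑ j, ∑ i, |v i| * A i j := by
    rw [Finset.sum_comm]
    simp_rw [← Finset.mul_sum, Matrix.sum_row_of_mem_rowStochastic hA, mul_one]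
  have habs : (fun i => |v i|) ᵥ* A = fun i => |v i| := by
    funext j
    exact ((Finset.sum_eq_sum_iff_of_le fun j _ => hle j).1 hsum j (Finset.mem_univ j)).symm
  have hpos : ∀ j, 0 < |v j| := fun j => by
    have := congrFun (vecMul_pow_of_vecMul_eq habs m) j
    rw [← this]
    change 0 < ∑ i, |v i| * (A ^ m) i j
    obtain ⟨i, hi⟩ := Function.ne_iff.1 hv
    exact Finset.sum_pos' (fun l _ => mul_nonneg (abs_nonneg _) (hm _ _).le)
      ⟨i, Finset.mem_univ _, mul_pos (abs_pos.2 hi) (hm _ _)⟩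
  have hs : 0 < ∑ j, |v j| := Finset.sum_pos (fun j _ => hpos j) Finset.univ_nonempty
  refine ⟨(∑ j, |v j|)⁻¹ • fun i => |v i|, ⟨?_, ?_⟩, fun i => ?_⟩
  · rw [Matrix.smul_vecMul, habs]
  · simp only [Pi.smul_apply, smul_eq_mul, ← Finset.mul_sum]
    exact inv_mul_cancel₀ hs.ne'
  · exact mul_pos (inv_pos.2 hs) (hpos i)

/-- The powers of a primitive row-stochastic matrix converge to `1 wᵀ`, with summable error. -/
theorem exists_sum_abs_pow_sub_le [NeZero n] {A : Matrix (Fin n) (Fin n) ℝ}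
    (hA : A ∈ Matrix.rowStochastic ℝ (Fin n)) {m : ℕ} (hm : ∀ i j, 0 < (A ^ m) i j)
    {w : Fin n → ℝ} (hw : IsNormalizedLeftEigenvector A w) (hw0 : ∀ i, 0 < w i) :
    ∃ e : ℕ → ℝ, (∀ k i j, |(A ^ k) i j - w j| ≤ e k) ∧
      ∃ C : ℝ, ∀ N, ∑ k ∈ Finset.range N, e k ≤ C := by
  -- Typed as a function rather than a matrix, so that `‖E k‖` is the largest absolute entry.
  let E : ℕ → Fin n → Fin n → ℝ := fun k i j => (A ^ k) i j - w j
  have hE : ∀ k i j, |E k i j| ≤ ‖E k‖ := fun k i j =>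
    (norm_le_pi_norm (E k i) j).trans (norm_le_pi_norm (E k) i)
  obtain ⟨⟨a, b⟩, hab⟩ := Finite.exists_min fun p : Fin n × Fin n => (A ^ m) p.1 p.2
  -- With `δ` the least entry of `A ^ m` and `w ≤ 1`, the matrix `A ^ m - δ 1 wᵀ` is nonnegative
  -- with row sums `1 - δ`. As `wᵀ E k = 0`, it acts on `E k` exactly as `A ^ m` does, whence the
  -- contraction.
  set δ := (A ^ m) a b with hδ
  have hδ0 : 0 < δ := hm a b
  have hw1 : ∀ i, w i ≤ 1 := fun i => by
    rw [← hw.2]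
    exact Finset.single_le_sum (fun j _ => (hw0 j).le) (Finset.mem_univ i)
  have hcoef : ∀ i l, 0 ≤ (A ^ m) i l - δ * w l := fun i l => by
    have h1 := hab (i, l)
    have h2 := mul_le_mul_of_nonneg_left (hw1 l) hδ0.le
    simp only at h1
    linarith
  have hrow : ∀ k i, ∑ l, (A ^ k) i l = 1 := fun k =>
    Matrix.sum_row_of_mem_rowStochastic (pow_mem hA k)
  have hwE : ∀ k j, ∑ l, w l * E k l j = 0 := fun k j => by
    have h1 : ∑ l, w l * (A ^ k) l j = w j := congrFun (vecMul_pow_of_vecMul_eq hw.1 k) j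
    simp only [E, mul_sub, Finset.sum_sub_distrib, ← Finset.sum_mul, hw.2, h1]
    ring
  have hstep : ∀ k i j, E (m + k) i j = ∑ l, ((A ^ m) i l - δ * w l) * E k l j := fun k i j => by
    have h1 : ∑ l, (A ^ m) i l * E k l j = E (m + k) i j := by
      simp only [E, mul_sub, Finset.sum_sub_distrib, ← Finset.sum_mul, hrow, pow_add,
        Matrix.mul_apply, one_mul]
    simp only [sub_mul, Finset.sum_sub_distrib, mul_assoc, ← Finset.mul_sum, hwE, h1]
    ring
  have hsumcoef : ∀ i, ∑ l, ((A ^ m) i l - δ * w l) = 1 - δ := fun i => by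
    rw [Finset.sum_sub_distrib, hrow, ← Finset.mul_sum, hw.2, mul_one]
  have hcontr : ∀ k, ‖E (m + k)‖ ≤ (1 - δ) * ‖E k‖ := fun k => by
    have hs : 0 ≤ 1 - δ := by
      rw [← hsumcoef a]
      exact Finset.sum_nonneg fun l _ => hcoef a l
    have hs' := mul_nonneg hs (norm_nonneg (E k))
    refine (pi_norm_le_iff_of_nonneg hs').2 fun i => (pi_norm_le_iff_of_nonneg hs').2 fun j => ?_
    rw [hstep, Real.norm_eq_abs, ← hsumcoef i, Finset.sum_mul]
    refine (Finset.abs_sum_le_sum_abs _ _).trans (Finset.sum_le_sum fun l _ => ?_)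
    rw [abs_mul, abs_of_nonneg (hcoef i l)]
    exact mul_le_mul_of_nonneg_left (hE k l j) (hcoef i l)
  -- If `s` is a partial sum of the norms and `s₀` the sum of the first `m`, the contraction gives
  -- `s ≤ s₀ + (1 - δ) s`, that is, `s ≤ s₀ / δ`.
  refine ⟨fun k => ‖E k‖, hE, (∑ k ∈ Finset.range m, ‖E k‖) / δ, fun N => ?_⟩
  rw [le_div_iff₀ hδ0]
  have h1 : ∑ k ∈ Finset.range N, ‖E k‖ ≤ ∑ k ∈ Finset.range (m + N), ‖E k‖ :=
    Finset.sum_le_sum_of_subset_of_nonneg (Finset.range_mono (by lia)) fun _ _ _ => norm_nonneg _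
  have h2 : ∑ k ∈ Finset.range N, ‖E (m + k)‖ ≤ (1 - δ) * ∑ k ∈ Finset.range N, ‖E k‖ := by
    rw [Finset.mul_sum]
    exact Finset.sum_le_sum fun k _ => hcontr k
  rw [Finset.sum_range_add] at h1
  linarith

/-- A normalized left eigenvector is determined by the limit of the powers. -/
theorem IsNormalizedLeftEigenvector.eq_of_sum_abs_pow_sub_le {A : Matrix (Fin n) (Fin n) ℝ}
    {w w' : Fin n → ℝ} (hw' : IsNormalizedLeftEigenvector A w') {e : ℕ → ℝ}
    (he : ∀ k i j, |(A ^ k) i j - w j| ≤ e k)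
    {C : ℝ} (hC : ∀ N, ∑ k ∈ Finset.range N, e k ≤ C) : w' = w := by
  funext j
  have he0 : ∀ k, 0 ≤ e k := fun k => (abs_nonneg _).trans (he k j j)
  have ht : Tendsto e atTop (𝓝 0) :=
    (summable_of_sum_range_le he0 hC).tendsto_atTop_zero
  have hd : ∀ k, |w' j - w j| ≤ (∑ i, |w' i|) * e k := fun k => by
    have h1 : ∑ i, w' i * (A ^ k) i j = w' j := congrFun (vecMul_pow_of_vecMul_eq hw'.1 k) j
    have h2 : w' j - w j = ∑ i, w' i * ((A ^ k) i j - w j) := by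
      simp only [mul_sub, Finset.sum_sub_distrib, ← Finset.sum_mul, h1, hw'.2, one_mul]
    rw [h2, Finset.sum_mul]
    refine (Finset.abs_sum_le_sum_abs _ _).trans (Finset.sum_le_sum fun l _ => ?_)
    rw [abs_mul]
    exact mul_le_mul_of_nonneg_left (he k l j) (abs_nonneg _)
  have h0 : |w' j - w j| ≤ 0 := by
    have := ge_of_tendsto' (ht.const_mul (∑ i, |w' i|)) hd
    simpa using this
  exact sub_eq_zero.1 (abs_nonpos_iff.1 h0)

end NetworkConsensus

/-! ### Eigenpairs of bounded perturbations of `a 1 1ᵀ` -/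

namespace NetworkConsensus

variable {ι : Type*} [Fintype ι] {a C μ : ℝ} {H M : Matrix ι ι ℝ}

theorem mulVec_rank_one_perturbation (hM : M = a • Matrix.vecMulVec (1 : ι → ℝ) 1 + H)
    (v : ι → ℝ) (i : ι) : (M *ᵥ v) i = a * ∑ j, v j + (H *ᵥ v) i := by
  subst hM
  rw [Matrix.add_mulVec, Matrix.smul_mulVec]
  simp [Matrix.mulVec, dotProduct]

theorem abs_mulVec_le (hH : ∀ i j, |H i j| ≤ C) {v : ι → ℝ} {r : ℝ} (hv : ∀ i, |v i| ≤ r)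
    (i : ι) : |(H *ᵥ v) i| ≤ Fintype.card ι * C * r := by
  have hC : 0 ≤ C := (abs_nonneg _).trans (hH i i)
  calc |(H *ᵥ v) i| ≤ ∑ j, |H i j * v j| := Finset.abs_sum_le_sum_abs _ _
    _ ≤ ∑ _j : ι, C * r := Finset.sum_le_sum fun j _ => by
        rw [abs_mul]; exact mul_le_mul (hH i j) (hv j) (abs_nonneg _) hC
    _ = _ := by simp [mul_assoc]

/-- The entries of an eigenvector of a bounded perturbation of `a 1 1ᵀ` are nearly equal. -/
theorem eigenvector_sub_le (hM : M = a • Matrix.vecMulVec (1 : ι → ℝ) 1 + H)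
    (hH : ∀ i j, |H i j| ≤ C) (hμ : 0 ≤ μ) {v : ι → ℝ} (hv : M *ᵥ v = μ • v)
    {r : ℝ} (hr : ∀ i, |v i| ≤ r) (i j : ι) :
    μ * |v i - v j| ≤ 2 * Fintype.card ι * C * r := by
  have h1 := congrFun hv i
  have h2 := congrFun hv j
  rw [mulVec_rank_one_perturbation hM, Pi.smul_apply, smul_eq_mul] at h1 h2
  -- The term `a * ∑ v` is common to both rows and cancels, leaving the difference of two entries of
  -- `H v`.
  have h3 := abs_mulVec_le hH hr i
  have h4 := abs_mulVec_le hH hr j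
  rw [← abs_of_nonneg hμ, ← abs_mul, mul_sub, ← h1, ← h2]
  rw [abs_le] at *
  constructor <;> linarith [h3.1, h3.2, h4.1, h4.2]

variable [DecidableEq ι]

theorem hasEigenvector_toLin'_iff {v : ι → ℝ} :
    Module.End.HasEigenvector (Matrix.toLin' M) μ v ↔ M *ᵥ v = μ • v ∧ v ≠ 0 := by
  rw [Module.End.hasEigenvector_iff, Module.End.mem_eigenspace_iff, Matrix.toLin'_apply]

theorem exists_hasEigenvector_eigenvalues (hM : M.IsHermitian)
    (i : ι) : ∃ v, Module.End.HasEigenvector (Matrix.toLin' M) (hM.eigenvalues i) v := by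
  refine ⟨hM.eigenvectorBasis i, hasEigenvector_toLin'_iff.2
    ⟨hM.mulVec_eigenvectorBasis i, fun h => ?_⟩⟩
  exact hM.eigenvectorBasis.toBasis.ne_zero i (by ext j; simpa using congrFun h j)

/-- A real symmetric matrix has a largest eigenvalue, which bounds its quadratic form. -/
theorem exists_isGreatest_eigenvalue [Nonempty ι] (hM : M.IsHermitian) :
    ∃ μ : ℝ, IsGreatest {ν : ℝ | Module.End.HasEigenvalue (Matrix.toLin' M) ν} μ ∧
      ∀ x : ι → ℝ, x ⬝ᵥ (M *ᵥ x) ≤ μ * (x ⬝ᵥ x) := by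
  have hfin : {ν : ℝ | Module.End.HasEigenvalue (Matrix.toLin' M) ν}.Finite :=
    Module.End.finite_hasEigenvalue _
  have hne : {ν : ℝ | Module.End.HasEigenvalue (Matrix.toLin' M) ν}.Nonempty := by
    obtain ⟨v, hv⟩ := exists_hasEigenvector_eigenvalues hM (Classical.arbitrary ι)
    exact ⟨_, Module.End.hasEigenvalue_of_hasEigenvector hv⟩
  obtain ⟨μ, hμ, hmax⟩ := Set.exists_max_image _ id hfin hne
  refine ⟨μ, ⟨hμ, hmax⟩, fun x => ?_⟩
  have hH : (μ • (1 : Matrix ι ι ℝ) - M).IsHermitian := by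
    refine Matrix.IsHermitian.sub ?_ hM
    rw [Matrix.IsHermitian, Matrix.conjTranspose_smul, Matrix.conjTranspose_one]
    simp
  -- An eigenvalue `η` of `μ - M` makes `μ - η` an eigenvalue of `M`, so `η ≥ 0` by maximality of
  -- `μ`.
  have hpsd : (μ • (1 : Matrix ι ι ℝ) - M).PosSemidef := by
    refine hH.posSemidef_iff_eigenvalues_nonneg.2 fun i => ?_
    obtain ⟨v, hv⟩ := exists_hasEigenvector_eigenvalues hH i
    rw [hasEigenvector_toLin'_iff] at hv
    have hv1 : M *ᵥ v = (μ - hH.eigenvalues i) • v := by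
      have := hv.1
      rw [Matrix.sub_mulVec, Matrix.smul_mulVec, Matrix.one_mulVec] at this
      rw [sub_smul, ← this]
      abel
    have := hmax _ (Module.End.hasEigenvalue_of_hasEigenvector
      (hasEigenvector_toLin'_iff.2 ⟨hv1, hv.2⟩))
    simpa using this
  have := hpsd.dotProduct_mulVec_nonneg x
  rw [Matrix.sub_mulVec, Matrix.smul_mulVec, Matrix.one_mulVec, dotProduct_sub,
    dotProduct_smul] at this
  simpa using this

/-- The largest eigenvalue of a positive semidefinite matrix is dominant. -/
theorem exists_isDominantEigenvalue_of_posSemidef [Nonempty ι] (hM : M.PosSemidef) :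
    ∃ μ : ℝ, 0 ≤ μ ∧ IsDominantEigenvalue M μ ∧
      ∀ x : ι → ℝ, x ⬝ᵥ (M *ᵥ x) ≤ μ * (x ⬝ᵥ x) := by
  obtain ⟨μ, hμ, hq⟩ := exists_isGreatest_eigenvalue hM.isHermitian
  have hnn : ∀ ν : ℝ, Module.End.HasEigenvalue (Matrix.toLin' M) ν → 0 ≤ ν := fun ν hν => by
    obtain ⟨v, hv⟩ := hν.exists_hasEigenvector
    rw [hasEigenvector_toLin'_iff] at hv
    have h1 := hM.dotProduct_mulVec_nonneg v
    rw [hv.1, dotProduct_smul] at h1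
    have h2 : 0 < v ⬝ᵥ v := by
      simpa using Matrix.dotProduct_star_self_pos_iff.2 hv.2
    simp only [star_trivial, smul_eq_mul] at h1
    exact nonneg_of_mul_nonneg_left h1 h2
  refine ⟨μ, hnn μ hμ.1, ⟨hμ, fun ν hν hne => ?_⟩, hq⟩
  rw [abs_of_nonneg (hnn ν hν), abs_of_nonneg (hnn μ hμ.1)]
  exact lt_of_le_of_ne (hμ.2 hν) hne

/-- The lower bound is the quadratic form evaluated at `1`. The upper bound reads the eigenvalue
equation in the row where the eigenvector is largest in absolute value. -/
theorem abs_eigenvalue_sub_le [Nonempty ι] (hM : M = a • Matrix.vecMulVec (1 : ι → ℝ) 1 + H)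
    (hH : ∀ i j, |H i j| ≤ C) (ha : 0 ≤ a)
    (hμ : IsGreatest {ν : ℝ | Module.End.HasEigenvalue (Matrix.toLin' M) ν} μ)
    (hq : ∀ x : ι → ℝ, x ⬝ᵥ (M *ᵥ x) ≤ μ * (x ⬝ᵥ x)) :
    |μ - Fintype.card ι * a| ≤ Fintype.card ι * C := by
  have hp : 0 < (Fintype.card ι : ℝ) := by exact_mod_cast Fintype.card_pos
  rw [abs_le]
  constructor
  · have h1 := hq 1
    have h2 : ∀ i, a * Fintype.card ι - Fintype.card ι * C ≤ (M *ᵥ (1 : ι → ℝ)) i := fun i => by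
      rw [mulVec_rank_one_perturbation hM]
      have := (abs_le.1 (abs_mulVec_le hH (v := 1) (r := 1) (by simp) i)).1
      simp only [Pi.one_apply, Finset.sum_const, Finset.card_univ, nsmul_eq_mul, mul_one] at *
      linarith
    have h3 : ∑ _i : ι, (a * Fintype.card ι - Fintype.card ι * C) ≤ μ * Fintype.card ι := by
      refine (Finset.sum_le_sum fun i _ => h2 i).trans ?_
      simpa [dotProduct] using h1
    simp only [Finset.sum_const, Finset.card_univ, nsmul_eq_mul] at h3
    rw [mul_comm] at h3
    have := le_of_mul_le_mul_right h3 hp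
    linarith
  · obtain ⟨v, hv⟩ := Module.End.HasEigenvalue.exists_hasEigenvector hμ.1
    rw [hasEigenvector_toLin'_iff] at hv
    obtain ⟨k, hk⟩ := Finite.exists_max fun i => |v i|
    have hk0 : 0 < |v k| := by
      obtain ⟨i, hi⟩ := Function.ne_iff.1 hv.2
      exact (abs_pos.2 hi).trans_le (hk i)
    have h1 := congrFun hv.1 k
    rw [mulVec_rank_one_perturbation hM, Pi.smul_apply, smul_eq_mul] at h1
    have h2 := abs_mulVec_le hH hk k
    have h3 : |a * ∑ j, v j| ≤ a * (Fintype.card ι * |v k|) := by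
      rw [abs_mul, abs_of_nonneg ha]
      refine mul_le_mul_of_nonneg_left ?_ ha
      refine (Finset.abs_sum_le_sum_abs _ _).trans ((Finset.sum_le_sum fun j _ => hk j).trans ?_)
      simp
    have h4 : μ * |v k| ≤ |μ * v k| := by
      rw [abs_mul]; exact mul_le_mul_of_nonneg_right (le_abs_self _) (abs_nonneg _)
    rw [← h1] at h4
    have h5 := h4.trans (abs_add_le _ _)
    have h6 : μ * |v k| ≤ (Fintype.card ι * a + Fintype.card ι * C) * |v k| := by linarith
    have := le_of_mul_le_mul_right h6 hk0
    linarith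

/-- An eigenvector close to the all-ones vector. -/
theorem exists_eigenvector_near_one (hM : M = a • Matrix.vecMulVec (1 : ι → ℝ) 1 + H)
    (hH : ∀ i j, |H i j| ≤ C) (hμ0 : 0 ≤ μ)
    (hμ : Module.End.HasEigenvalue (Matrix.toLin' M) μ) :
    ∃ c : ι → ℝ, Module.End.HasEigenvector (Matrix.toLin' M) μ (1 + c) ∧
      ∀ i, μ * |c i| ≤ 2 * Fintype.card ι * C := by
  obtain ⟨v, hv⟩ := Module.End.HasEigenvalue.exists_hasEigenvector hμ
  rw [hasEigenvector_toLin'_iff] at hv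
  obtain ⟨i, hi⟩ := Function.ne_iff.1 hv.2
  have : Nonempty ι := ⟨i⟩
  obtain ⟨k, hk⟩ := Finite.exists_max fun i => |v i|
  have hk0 : 0 < |v k| := (abs_pos.2 hi).trans_le (hk i)
  have hvk : v k ≠ 0 := abs_pos.1 hk0
  -- Dividing by the entry of largest absolute value makes that entry `1`; the others are close to
  -- it by `eigenvector_sub_le`.
  refine ⟨(v k)⁻¹ • v - 1, ?_, fun j => ?_⟩
  · rw [add_sub_cancel, hasEigenvector_toLin'_iff, Matrix.mulVec_smul, hv.1, smul_comm]
    exact ⟨rfl, smul_ne_zero (inv_ne_zero hvk) hv.2⟩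
  · have h1 := eigenvector_sub_le hM hH hμ0 hv.1 hk j k
    have h2 : ((v k)⁻¹ • v - 1) j = (v j - v k) / v k := by
      simp only [Pi.sub_apply, Pi.smul_apply, smul_eq_mul, Pi.one_apply]
      field_simp
    rw [h2, abs_div, ← mul_div_assoc, div_le_iff₀ hk0]
    exact h1

/-- Once the eigenvalue dominates the perturbation, the eigenspace is a line. -/
theorem eigenspace_eq_span_of_lt (hM : M = a • Matrix.vecMulVec (1 : ι → ℝ) 1 + H)
    (hH : ∀ i j, |H i j| ≤ C) (hμ : 2 * Fintype.card ι * C < μ) (hμ0 : 0 ≤ μ)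
    {v : ι → ℝ} (hv : Module.End.HasEigenvector (Matrix.toLin' M) μ v) :
    Module.End.eigenspace (Matrix.toLin' M) μ = Submodule.span ℝ {v} := by
  rw [hasEigenvector_toLin'_iff] at hv
  obtain ⟨i, hi⟩ := Function.ne_iff.1 hv.2
  have : Nonempty ι := ⟨i⟩
  -- If `x` vanishes at `b`, its largest entry satisfies `μ |x k| ≤ 2 * card * C * |x k|`, which
  -- forces `x = 0`. A vector of the eigenspace is thus determined by one coordinate.
  have hzero : ∀ x : ι → ℝ, M *ᵥ x = μ • x → ∀ b, x b = 0 → x = 0 := fun x hx b hb => by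
    obtain ⟨k, hk⟩ := Finite.exists_max fun i => |x i|
    have h1 := eigenvector_sub_le hM hH hμ0 hx hk k b
    rw [hb, sub_zero] at h1
    have h2 : |x k| ≤ 0 := by
      by_contra! h
      have := mul_lt_mul_of_pos_right hμ h
      linarith
    funext j
    exact abs_nonpos_iff.1 ((hk j).trans h2)
  ext x
  rw [Module.End.mem_eigenspace_iff, Matrix.toLin'_apply, Submodule.mem_span_singleton]
  constructor
  · intro hx
    refine ⟨x i / v i, ?_⟩
    have h1 : M *ᵥ (x - (x i / v i) • v) = μ • (x - (x i / v i) • v) := by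
      rw [Matrix.mulVec_sub, Matrix.mulVec_smul, hx, hv.1, smul_sub, smul_comm μ]
    have hi' : v i ≠ 0 := hi
    exact (sub_eq_zero.1 (hzero _ h1 i (by simp [hi']))).symm
  · rintro ⟨t, rfl⟩
    rw [Matrix.mulVec_smul, hv.1, smul_comm]

end NetworkConsensus

/-! ### Least-energy control through the Gramian -/

namespace NetworkConsensus

variable {n : ℕ} {A : Matrix (Fin n) (Fin n) ℝ} {S T : Finset (Fin n)}

/-- The response `C Aⁱ B` of the target nodes to an input applied `i` steps earlier. -/
def targetResponse (A : Matrix (Fin n) (Fin n) ℝ) (S T : Finset (Fin n)) (i : ℕ) :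
    Matrix T S ℝ :=
  outputMatrix T * (A ^ i * inputMatrix S)

theorem targetResponse_apply (i : ℕ) (t : T) (s : S) :
    targetResponse A S T i t s = (A ^ i) t s := by
  simp [targetResponse, outputMatrix, inputMatrix, Matrix.mul_apply]

theorem gramianSub_eq_sum (kf : ℕ) :
    gramianSub A S T kf =
      ∑ i ∈ Finset.range kf, targetResponse A S T i * (targetResponse A S T i)ᵀ := by
  ext t t'
  simp only [gramianSub, gramian, Matrix.submatrix_apply, Matrix.sum_apply, Matrix.mul_apply,
    Matrix.transpose_apply, targetResponse_apply]
  simp [inputMatrix]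

theorem gramianSub_apply (kf : ℕ) (t t' : T) :
    gramianSub A S T kf t t' =
      ∑ i ∈ Finset.range kf, ∑ s ∈ S, (A ^ i) t s * (A ^ i) t' s := by
  rw [gramianSub_eq_sum, Matrix.sum_apply]
  refine Finset.sum_congr rfl fun i _ => ?_
  rw [Matrix.mul_apply, ← Finset.sum_coe_sort S]
  simp only [Matrix.transpose_apply, targetResponse_apply]

theorem gramianSub_posSemidef (kf : ℕ) : (gramianSub A S T kf).PosSemidef := by
  rw [gramianSub_eq_sum]
  refine Matrix.posSemidef_sum _ fun i _ => ?_
  simpa using Matrix.posSemidef_self_mul_conjTranspose (targetResponse A S T i)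

theorem gramianSub_transpose (kf : ℕ) : (gramianSub A S T kf)ᵀ = gramianSub A S T kf := by
  simpa [Matrix.IsHermitian] using (gramianSub_posSemidef (A := A) (S := S) (T := T) kf).isHermitian

theorem state_eq_sum (u : ℕ → S → ℝ) (k : ℕ) :
    state A S u k = ∑ i ∈ Finset.range k, (A ^ (k - 1 - i) * inputMatrix S) *ᵥ u i := by
  induction k with
  | zero => simp [state]
  | succ k ih =>
    rw [state, ih, Finset.sum_range_succ, Matrix.mulVec_sum]
    congr 1
    · refine Finset.sum_congr rfl fun i hi => ?_
      rw [Finset.mem_range] at hi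
      rw [Matrix.mulVec_mulVec, ← Matrix.mul_assoc, ← pow_succ']
      congr 3
      lia
    · simp

theorem targetState_eq_sum (u : ℕ → S → ℝ) (k : ℕ) :
    targetState A S T u k = ∑ i ∈ Finset.range k, targetResponse A S T (k - 1 - i) *ᵥ u i := by
  rw [targetState, state_eq_sum, Matrix.mulVec_sum]
  simp only [Matrix.mulVec_mulVec, targetResponse]

/-- The input with co-state `z`; it drives the targets to `W(T, kf) z` with least energy. -/
def dualInput (A : Matrix (Fin n) (Fin n) ℝ) (S T : Finset (Fin n)) (kf : ℕ) (z : T → ℝ) :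
    ℕ → S → ℝ :=
  fun i => (targetResponse A S T (kf - 1 - i))ᵀ *ᵥ z

theorem targetState_dualInput (kf : ℕ) (z : T → ℝ) :
    targetState A S T (dualInput A S T kf z) kf = gramianSub A S T kf *ᵥ z := by
  -- The sample at time `i` acts through the response of index `kf - 1 - i`, so time is reversed to
  -- match the Gramian sum.
  rw [targetState_eq_sum, gramianSub_eq_sum, Matrix.sum_mulVec,
    ← Finset.sum_range_reflect]
  refine Finset.sum_congr rfl fun i hi => ?_
  rw [Finset.mem_range] at hi
  rw [dualInput, Matrix.mulVec_mulVec, show kf - 1 - (kf - 1 - i) = i by lia]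

/-- The map from co-states to inputs is the adjoint of the map from inputs to target states. Hence
the pairing of `u` with a dual input depends only on the target state that `u` reaches. -/
theorem sum_dotProduct_dualInput (kf : ℕ) (z : T → ℝ) (u : ℕ → S → ℝ) :
    ∑ i ∈ Finset.range kf, u i ⬝ᵥ dualInput A S T kf z i = z ⬝ᵥ targetState A S T u kf := by
  rw [targetState_eq_sum, dotProduct_sum]
  refine Finset.sum_congr rfl fun i _ => ?_
  rw [dualInput, Matrix.mulVec_transpose, dotProduct_comm, ← Matrix.dotProduct_mulVec]

/-- The target-control energy of the goal `W(T, kf) z` is `zᵀ W(T, kf) z`. -/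
theorem isTargetControlEnergy_gramianSub_mulVec (kf : ℕ) (z : T → ℝ) :
    IsTargetControlEnergy A S T kf (gramianSub A S T kf *ᵥ z)
      (z ⬝ᵥ (gramianSub A S T kf *ᵥ z)) := by
  have hd : inputEnergy kf (dualInput A S T kf z) = z ⬝ᵥ (gramianSub A S T kf *ᵥ z) := by
    rw [inputEnergy, sum_dotProduct_dualInput, targetState_dualInput]
  refine ⟨⟨dualInput A S T kf z, targetState_dualInput kf z, hd⟩, ?_⟩
  rintro _ ⟨u, hu, rfl⟩
  -- All inputs reaching this goal have the same pairing with the dual input, namely the energy of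
  -- the latter. So the energy of the difference is the difference of the energies, and it is
  -- nonnegative.
  have h1 := sum_dotProduct_dualInput (A := A) kf z u
  rw [hu, ← hd] at h1
  have h2 : 0 ≤ ∑ i ∈ Finset.range kf,
      (u i - dualInput A S T kf z i) ⬝ᵥ (u i - dualInput A S T kf z i) :=
    Finset.sum_nonneg fun i _ => by
      have := dotProduct_star_self_nonneg (u i - dualInput A S T kf z i)
      rwa [star_trivial] at this
  have h3 : ∑ i ∈ Finset.range kf,
      (u i - dualInput A S T kf z i) ⬝ᵥ (u i - dualInput A S T kf z i) =
      inputEnergy kf u - 2 * (∑ i ∈ Finset.range kf, u i ⬝ᵥ dualInput A S T kf z i) +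
        inputEnergy kf (dualInput A S T kf z) := by
    simp only [inputEnergy, Finset.mul_sum, ← Finset.sum_sub_distrib, ← Finset.sum_add_distrib]
    refine Finset.sum_congr rfl fun i _ => ?_
    rw [sub_dotProduct, dotProduct_sub, dotProduct_sub,
      dotProduct_comm (dualInput A S T kf z i) (u i)]
    ring
  rw [h1] at h3
  rw [← hd]
  linarith

/-- A quadratic form of the Gramian vanishes only on co-states orthogonal to all reachable
target states. -/
theorem dotProduct_targetState_eq_zero {kf : ℕ} {z : T → ℝ}
    (hz : z ⬝ᵥ (gramianSub A S T kf *ᵥ z) = 0) (u : ℕ → S → ℝ) :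
    z ⬝ᵥ targetState A S T u kf = 0 := by
  -- The form is the energy of the dual input, so each of its samples before `kf` vanishes.
  rw [← targetState_dualInput, ← sum_dotProduct_dualInput] at hz
  have hnn : ∀ x : S → ℝ, 0 ≤ x ⬝ᵥ x := fun x => by simpa using dotProduct_star_self_nonneg x
  rw [← sum_dotProduct_dualInput]
  refine Finset.sum_eq_zero fun i hi => ?_
  have := (Finset.sum_eq_zero_iff_of_nonneg fun i _ => hnn _).1 hz i hi
  rw [dotProduct_self_eq_zero.1 this, dotProduct_zero]

variable {kf : ℕ} {μ : ℝ}

theorem unitize_dotProduct_self {ι : Type*} [Fintype ι] {v : ι → ℝ} (hv : v ≠ 0) :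
    unitize v ⬝ᵥ unitize v = 1 := by
  have hvv : 0 < v ⬝ᵥ v := by simpa using Matrix.dotProduct_star_self_pos_iff.2 hv
  rw [unitize, smul_dotProduct, dotProduct_smul, smul_eq_mul, smul_eq_mul, ← mul_assoc,
    ← mul_inv, Real.mul_self_sqrt hvv.le, inv_mul_cancel₀ hvv.ne']

/-- Unit vectors in the span of `v` are `± unitize v`. -/
theorem eq_unitize_or_eq_neg_unitize {ι : Type*} [Fintype ι] {v y : ι → ℝ} (hv : v ≠ 0)
    (hy : y ∈ Submodule.span ℝ {v}) (hy1 : y ⬝ᵥ y = 1) : y = unitize v ∨ y = -unitize v := by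
  have hvv : 0 < v ⬝ᵥ v := by simpa using Matrix.dotProduct_star_self_pos_iff.2 hv
  obtain ⟨a, rfl⟩ := Submodule.mem_span_singleton.1 hy
  have hs : √(v ⬝ᵥ v) ≠ 0 := (Real.sqrt_pos.2 hvv).ne'
  have ha : (a * √(v ⬝ᵥ v)) ^ 2 = 1 := by
    rw [mul_pow, Real.sq_sqrt hvv.le]
    rw [smul_dotProduct, dotProduct_smul, smul_eq_mul, smul_eq_mul] at hy1
    linarith
  rcases (sq_eq_sq_iff_eq_or_eq_neg.1 (ha.trans (one_pow 2).symm)) with h | h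
  · left
    rw [unitize, eq_inv_of_mul_eq_one_left h]
  · right
    rw [unitize, ← neg_smul, ← eq_inv_of_mul_eq_one_left (b := √(v ⬝ᵥ v)) (a := -a) (by linarith),
      neg_neg]

/-- Here `y = Q (μ⁻¹ y)`, and the energy formula gives `yᵀ y / μ`. -/
theorem isTargetControlEnergy_of_mulVec_eq_smul (hμ : μ ≠ 0) {y : T → ℝ}
    (hy : gramianSub A S T kf *ᵥ y = μ • y) (hy1 : y ⬝ᵥ y = 1) :
    IsTargetControlEnergy A S T kf y (1 / μ) := by
  have := isTargetControlEnergy_gramianSub_mulVec (A := A) (S := S) kf (μ⁻¹ • y)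
  rw [Matrix.mulVec_smul, hy, smul_smul, inv_mul_cancel₀ hμ, one_smul, smul_dotProduct, hy1] at this
  simpa using this

/-- Completing the square at `μ z - y` for a goal `y = W(T, kf) z`. -/
theorem sub_form_le {z : T → ℝ}
    (hq : ∀ x : T → ℝ, x ⬝ᵥ (gramianSub A S T kf *ᵥ x) ≤ μ * (x ⬝ᵥ x))
    (hy1 : (gramianSub A S T kf *ᵥ z) ⬝ᵥ (gramianSub A S T kf *ᵥ z) = 1) :
    (μ • z - gramianSub A S T kf *ᵥ z) ⬝ᵥ
      (gramianSub A S T kf *ᵥ (μ • z - gramianSub A S T kf *ᵥ z)) ≤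
      μ ^ 2 * (z ⬝ᵥ (gramianSub A S T kf *ᵥ z)) - μ := by
  set Q := gramianSub A S T kf with hQ
  have hsym : ∀ x, z ⬝ᵥ (Q *ᵥ x) = (Q *ᵥ z) ⬝ᵥ x := fun x => by
    rw [Matrix.dotProduct_mulVec, ← Matrix.mulVec_transpose, hQ, gramianSub_transpose]
  -- With `y = Q z`, the left side expands to `μ² zᵀ y - 2 μ yᵀ y + yᵀ Q y`, where `yᵀ y = 1` and
  -- `yᵀ Q y ≤ μ`.
  have h1 := hq (Q *ᵥ z)
  rw [Matrix.mulVec_sub, Matrix.mulVec_smul, sub_dotProduct, dotProduct_sub, dotProduct_sub,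
    smul_dotProduct, smul_dotProduct, dotProduct_smul, dotProduct_smul, hsym (Q *ᵥ z), hy1]
  rw [hy1] at h1
  simp only [smul_eq_mul]
  linarith

/-- The form at `μ z - y` is nonnegative, so `sub_form_le` yields the bound without inverting `Q`;
definiteness is needed only for the equality case. -/
theorem one_div_le_energy {z : T → ℝ} (hμ : 0 < μ)
    (hq : ∀ x : T → ℝ, x ⬝ᵥ (gramianSub A S T kf *ᵥ x) ≤ μ * (x ⬝ᵥ x))
    (hy1 : (gramianSub A S T kf *ᵥ z) ⬝ᵥ (gramianSub A S T kf *ᵥ z) = 1) :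
    1 / μ ≤ z ⬝ᵥ (gramianSub A S T kf *ᵥ z) := by
  have h1 := (gramianSub_posSemidef (A := A) (S := S) (T := T) kf).dotProduct_mulVec_nonneg
    (μ • z - gramianSub A S T kf *ᵥ z)
  rw [star_trivial] at h1
  have h2 := h1.trans (sub_form_le hq hy1)
  rw [div_le_iff₀ hμ]
  have h3 : 0 ≤ μ * ((z ⬝ᵥ (gramianSub A S T kf *ᵥ z)) * μ - 1) := by linarith
  linarith [nonneg_of_mul_nonneg_right h3 hμ]

namespace TargetControllable

/-- Such a `z` is orthogonal to every reachable target state, and `z` is itself reachable. -/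
theorem eq_zero_of_dotProduct_mulVec_eq_zero (h : TargetControllable A S T kf) {z : T → ℝ}
    (hz : z ⬝ᵥ (gramianSub A S T kf *ᵥ z) = 0) : z = 0 := by
  obtain ⟨u, hu⟩ := h z
  have := dotProduct_targetState_eq_zero hz u
  rw [hu] at this
  exact dotProduct_self_eq_zero.1 this

theorem exists_gramianSub_mulVec_eq (h : TargetControllable A S T kf) (y : T → ℝ) :
    ∃ z, gramianSub A S T kf *ᵥ z = y := by
  have hinj : Function.Injective (Matrix.toLin' (gramianSub A S T kf)) := by
    refine (injective_iff_map_eq_zero _).2 fun z hz => ?_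
    rw [Matrix.toLin'_apply] at hz
    exact h.eq_zero_of_dotProduct_mulVec_eq_zero (by rw [hz, dotProduct_zero])
  obtain ⟨z, hz⟩ := LinearMap.injective_iff_surjective.1 hinj y
  exact ⟨z, by rwa [Matrix.toLin'_apply] at hz⟩

theorem exists_isTargetControlEnergy (h : TargetControllable A S T kf) (y : T → ℝ) :
    ∃ e, IsTargetControlEnergy A S T kf y e := by
  obtain ⟨z, rfl⟩ := h.exists_gramianSub_mulVec_eq y
  exact ⟨_, isTargetControlEnergy_gramianSub_mulVec kf z⟩

theorem eigenvalue_pos (h : TargetControllable A S T kf) {v : T → ℝ}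
    (hv : Module.End.HasEigenvector (Matrix.toLin' (gramianSub A S T kf)) μ v) : 0 < μ := by
  rw [hasEigenvector_toLin'_iff] at hv
  have hvv : 0 < v ⬝ᵥ v := by simpa using Matrix.dotProduct_star_self_pos_iff.2 hv.2
  have h1 := (gramianSub_posSemidef (A := A) (S := S) (T := T) kf).dotProduct_mulVec_nonneg v
  have h2 : v ⬝ᵥ (gramianSub A S T kf *ᵥ v) ≠ 0 := fun h0 =>
    hv.2 (h.eq_zero_of_dotProduct_mulVec_eq_zero h0)
  rw [star_trivial] at h1
  have h3 := lt_of_le_of_ne h1 h2.symm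
  rw [hv.1, dotProduct_smul, smul_eq_mul] at h3
  exact (pos_iff_pos_of_mul_pos h3).2 hvv

/-- The target security is the reciprocal of the dominant eigenvalue. -/
theorem isTargetSecurity (h : TargetControllable A S T kf)
    (hμ : Module.End.HasEigenvalue (Matrix.toLin' (gramianSub A S T kf)) μ)
    (hq : ∀ x : T → ℝ, x ⬝ᵥ (gramianSub A S T kf *ᵥ x) ≤ μ * (x ⬝ᵥ x)) :
    IsTargetSecurity A S T kf (1 / μ) := by
  obtain ⟨v, hv⟩ := hμ.exists_hasEigenvector
  have hμ0 := h.eigenvalue_pos hv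
  rw [hasEigenvector_toLin'_iff] at hv
  refine ⟨⟨unitize v, unitize_dotProduct_self hv.2,
    isTargetControlEnergy_of_mulVec_eq_smul hμ0.ne' ?_ (unitize_dotProduct_self hv.2)⟩, ?_⟩
  · rw [unitize, Matrix.mulVec_smul, hv.1, smul_comm]
  · rintro e ⟨y, hy1, he⟩
    obtain ⟨z, rfl⟩ := h.exists_gramianSub_mulVec_eq y
    rw [he.unique (isTargetControlEnergy_gramianSub_mulVec kf z)]
    exact one_div_le_energy hμ0 hq hy1

/-- The minimally secure goals are the unit eigenvectors for the dominant eigenvalue. -/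
theorem isMinimallySecureGoal_iff (h : TargetControllable A S T kf)
    (hμ : Module.End.HasEigenvalue (Matrix.toLin' (gramianSub A S T kf)) μ)
    (hq : ∀ x : T → ℝ, x ⬝ᵥ (gramianSub A S T kf *ᵥ x) ≤ μ * (x ⬝ᵥ x)) (y : T → ℝ) :
    IsMinimallySecureGoal A S T kf y ↔ y ⬝ᵥ y = 1 ∧ gramianSub A S T kf *ᵥ y = μ • y := by
  have hμ0 : 0 < μ := by
    obtain ⟨v, hv⟩ := hμ.exists_hasEigenvector
    exact h.eigenvalue_pos hv
  have hsec := h.isTargetSecurity hμ hq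
  constructor
  · rintro ⟨hy1, E, hE, hyE⟩
    refine ⟨hy1, ?_⟩
    rw [hE.unique hsec] at hyE
    obtain ⟨z, rfl⟩ := h.exists_gramianSub_mulVec_eq y
    -- Equality case: at energy `1 / μ` the form at `μ z - y` is zero, so `y = μ z` by definiteness,
    -- and applying `Q` gives `Q y = μ y`.
    have h1 := sub_form_le hq hy1
    rw [← hyE.unique (isTargetControlEnergy_gramianSub_mulVec kf z)] at h1
    have h2 : μ ^ 2 * (1 / μ) - μ = 0 := by field_simp; ring
    have h3 := (gramianSub_posSemidef (A := A) (S := S) (T := T) kf).dotProduct_mulVec_nonneg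
      (μ • z - gramianSub A S T kf *ᵥ z)
    rw [star_trivial] at h3
    have h4 := h.eq_zero_of_dotProduct_mulVec_eq_zero (le_antisymm (h1.trans_eq h2) h3)
    rw [← sub_eq_zero.1 h4, Matrix.mulVec_smul, sub_eq_zero.1 h4]
  · rintro ⟨hy1, hy⟩
    exact ⟨hy1, _, hsec, isTargetControlEnergy_of_mulVec_eq_smul hμ0.ne' hy hy1⟩

end TargetControllable

end NetworkConsensus

/-! ### Asymptotics of the consensus Gramian and the main theorem -/

namespace NetworkConsensus

variable {n : ℕ} {A : Matrix (Fin n) (Fin n) ℝ} {S : Finset (Fin n)} {w : Fin n → ℝ}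

/-- The Gramian of a consensus network is a bounded perturbation of `kf (∑ wᵢ²) 1 1ᵀ`. -/
theorem abs_gramianSub_sub_le (hA : A ∈ Matrix.rowStochastic ℝ (Fin n))
    (hw : IsNormalizedLeftEigenvector A w) (hw0 : ∀ i, 0 < w i) {e : ℕ → ℝ}
    (he : ∀ k i j, |(A ^ k) i j - w j| ≤ e k)
    {C : ℝ} (hC : ∀ N, ∑ k ∈ Finset.range N, e k ≤ C) (B : Finset (Fin n)) (kf : ℕ) (b b' : B) :
    |gramianSub A S B kf b b' - kf * ∑ i ∈ S, w i ^ 2| ≤ 2 * S.card * C := by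
  have hw1 : ∀ i, w i ≤ 1 := fun i => by
    rw [← hw.2]
    exact Finset.single_le_sum (fun j _ => (hw0 j).le) (Finset.mem_univ i)
  -- Replacing the two factors by `w s` one at a time costs `e k` each, since the other factor lies
  -- in `[0, 1]`.
  have hterm : ∀ k s, |(A ^ k) b s * (A ^ k) b' s - w s ^ 2| ≤ 2 * e k := fun k s => by
    have hk := pow_mem hA k
    have h0 := Matrix.nonneg_of_mem_rowStochastic hk (i := b) (j := s)
    have h1 := Matrix.le_one_of_mem_rowStochastic hk (i := b) (j := s)
    have hb : |((A ^ k) b s - w s) * w s| ≤ e k := by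
      rw [abs_mul, abs_of_pos (hw0 s)]
      exact (mul_le_of_le_one_right (abs_nonneg _) (hw1 s)).trans (he k b s)
    have hb' : |(A ^ k) b s * ((A ^ k) b' s - w s)| ≤ e k := by
      rw [abs_mul, abs_of_nonneg h0]
      exact (mul_le_of_le_one_left (abs_nonneg _) h1).trans (he k b' s)
    calc _ = |(A ^ k) b s * ((A ^ k) b' s - w s) + ((A ^ k) b s - w s) * w s| := by
          congr 1; ring
      _ ≤ _ := (abs_add_le _ _).trans (by linarith)
  have hsum : gramianSub A S B kf b b' - kf * ∑ i ∈ S, w i ^ 2 =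
      ∑ k ∈ Finset.range kf, ∑ s ∈ S, ((A ^ k) b s * (A ^ k) b' s - w s ^ 2) := by
    simp only [gramianSub_apply, Finset.sum_sub_distrib, Finset.sum_const, Finset.card_range,
      nsmul_eq_mul]
  rw [hsum]
  calc _ ≤ ∑ k ∈ Finset.range kf, ∑ s ∈ S, |(A ^ k) b s * (A ^ k) b' s - w s ^ 2| :=
        (Finset.abs_sum_le_sum_abs _ _).trans
          (Finset.sum_le_sum fun k _ => Finset.abs_sum_le_sum_abs _ _)
    _ ≤ ∑ k ∈ Finset.range kf, ∑ _s ∈ S, 2 * e k :=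
        Finset.sum_le_sum fun k _ => Finset.sum_le_sum fun s _ => hterm k s
    _ = 2 * S.card * ∑ k ∈ Finset.range kf, e k := by
        simp only [Finset.sum_const, nsmul_eq_mul, Finset.mul_sum]
        exact Finset.sum_congr rfl fun k _ => by ring
    _ ≤ _ := mul_le_mul_of_nonneg_left (hC kf) (by positivity)

/-- Dominant eigenvalues and eigenvectors of a sequence of positive semidefinite bounded
perturbations of `k σ 1 1ᵀ`. -/
theorem exists_dominant_eigenpairs {ι : Type*} [Fintype ι] [DecidableEq ι] [Nonempty ι]
    {Q H : ℕ → Matrix ι ι ℝ} {σ C : ℝ} (hσ : 0 < σ) (hQ : ∀ k, (Q k).PosSemidef)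
    (hH : ∀ k i j, |H k i j| ≤ C)
    (hQH : ∀ k : ℕ, Q k = ((k : ℝ) * σ) • Matrix.vecMulVec (1 : ι → ℝ) 1 + H k) :
    ∃ (lam : ℕ → ℝ) (c : ℕ → ι → ℝ),
      (∀ k, IsDominantEigenvalue (Q k) (lam k)) ∧
      (∀ k, ∀ x : ι → ℝ, x ⬝ᵥ (Q k *ᵥ x) ≤ lam k * (x ⬝ᵥ x)) ∧
      (∀ k : ℕ, |lam k - Fintype.card ι * (k * σ)| ≤ Fintype.card ι * C) ∧
      Tendsto lam atTop atTop ∧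
      (∀ i, Tendsto (fun k => c k i) atTop (𝓝 0)) ∧
      (∀ k, Module.End.HasEigenvector (Matrix.toLin' (Q k)) (lam k) (1 + c k)) ∧
      ∀ᶠ k : ℕ in atTop, Module.End.eigenspace (Matrix.toLin' (Q k)) (lam k) =
        Submodule.span ℝ {1 + c k} := by
  choose lam hlam0 hdom hq using fun k => exists_isDominantEigenvalue_of_posSemidef (hQ k)
  choose c hc hcle using fun k =>
    exists_eigenvector_near_one (hQH k) (hH k) (hlam0 k) (hdom k).1.1
  have hbound : ∀ k : ℕ, |lam k - Fintype.card ι * (k * σ)| ≤ Fintype.card ι * C := fun k =>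
    abs_eigenvalue_sub_le (hQH k) (hH k) (by positivity) (hdom k).1 (hq k)
  have hp : 0 < (Fintype.card ι : ℝ) := by exact_mod_cast Fintype.card_pos
  have htend : Tendsto lam atTop atTop := by
    have h1 : Tendsto (fun k : ℕ => (Fintype.card ι : ℝ) * (k * σ) + -(Fintype.card ι * C))
        atTop atTop :=
      tendsto_atTop_add_const_right _ _
        ((tendsto_natCast_atTop_atTop.atTop_mul_const hσ).const_mul_atTop hp)
    refine tendsto_atTop_mono (fun k => ?_) h1
    linarith [(abs_le.1 (hbound k)).1]
  refine ⟨lam, c, hdom, hq, hbound, htend, fun i => ?_, hc, ?_⟩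
  -- Only `lam k * |c k i|` is bounded for every `k`; dividing requires `lam k > 0`, which holds
  -- eventually.
  · refine squeeze_zero_norm' ?_ (htend.const_div_atTop (2 * Fintype.card ι * C))
    filter_upwards [htend.eventually_gt_atTop 0] with k hk
    rw [Real.norm_eq_abs, le_div_iff₀ hk, mul_comm]
    exact hcle k i
  · filter_upwards [htend.eventually_gt_atTop (2 * Fintype.card ι * C)] with k hk
    exact eigenspace_eq_span_of_lt (hQH k) (hH k) hk (hlam0 k) (hc k)

end NetworkConsensus

theorem theorem5 {n : ℕ} (A : Matrix (Fin n) (Fin n) ℝ) (hA : IsConsensusMatrix A)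
    (S : Finset (Fin n)) (hS : S.Nonempty) :
    ∃ w : Fin n → ℝ,
      -- `w` is the normalized left Perron vector of `A`
      (IsNormalizedLeftEigenvector A w ∧ (∀ i, 0 < w i) ∧
        ∀ w' : Fin n → ℝ, IsNormalizedLeftEigenvector A w' → w' = w) ∧
      -- the Gramian submatrix
      (∀ B : Finset (Fin n), B.Nonempty →
        (∃ H : ℕ → Matrix B B ℝ,
          (∃ C : ℝ, ∀ kf i j, |H kf i j| ≤ C) ∧
          ∀ kf : ℕ, gramianSub A S B kf =
            ((kf : ℝ) * ∑ i ∈ S, w i ^ 2) • Matrix.vecMulVec (1 : B → ℝ) (1 : B → ℝ) + H kf) ∧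
        ∃ (lam lamHat : ℕ → ℝ) (c : ℕ → B → ℝ),
          (∀ kf : ℕ, IsDominantEigenvalue (gramianSub A S B kf) (lam kf)) ∧
          (∀ kf : ℕ, lam kf = (B.card : ℝ) * kf * ∑ i ∈ S, w i ^ 2 + lamHat kf) ∧
          (∃ C : ℝ, ∀ kf, |lamHat kf| ≤ C) ∧
          (∀ b, Tendsto (fun kf => c kf b) atTop (𝓝 0)) ∧
          (∀ kf : ℕ, Module.End.HasEigenvector (Matrix.toLin' (gramianSub A S B kf))
            (lam kf) (1 + c kf)) ∧
          ∀ᶠ kf : ℕ in atTop, Module.End.eigenspace (Matrix.toLin' (gramianSub A S B kf))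
            (lam kf) = Submodule.span ℝ {1 + c kf}) ∧
      -- target control
      ∀ T : Finset (Fin n), T.Nonempty →
        (∀ kf : ℕ, TargetControllable A S T kf →
          ∀ y : T → ℝ, ∃ e : ℝ, IsTargetControlEnergy A S T kf y e) ∧
        (∃ EHat : ℕ → ℝ, Tendsto EHat atTop (𝓝 0) ∧
          ∀ kf : ℕ, TargetControllable A S T kf →
            IsTargetSecurity A S T kf
              (1 / ((T.card : ℝ) * kf * ∑ i ∈ S, w i ^ 2) + EHat kf)) ∧
        ∃ c : ℕ → T → ℝ, (∀ t, Tendsto (fun kf => c kf t) atTop (𝓝 0)) ∧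
          (∀ kf : ℕ, TargetControllable A S T kf →
            IsMinimallySecureGoal A S T kf (unitize (1 + c kf))) ∧
          ∀ᶠ kf : ℕ in atTop, TargetControllable A S T kf →
            ∀ y : T → ℝ, IsMinimallySecureGoal A S T kf y →
              y = unitize (1 + c kf) ∨ y = -unitize (1 + c kf) := by
  have : NeZero n := ⟨by
    rintro rfl
    obtain ⟨i, -⟩ := hS
    exact i.elim0⟩
  obtain ⟨m, hm⟩ := hA.exists_pow_pos
  obtain ⟨w, hw, hw0⟩ := exists_pos_isNormalizedLeftEigenvector hA.stochastic hm
  obtain ⟨e, he, C, hC⟩ := exists_sum_abs_pow_sub_le hA.stochastic hm hw hw0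
  have hσ : 0 < ∑ i ∈ S, w i ^ 2 := Finset.sum_pos (fun i _ => pow_pos (hw0 i) 2) hS
  let H : ∀ B : Finset (Fin n), ℕ → Matrix B B ℝ := fun B kf =>
    gramianSub A S B kf - ((kf : ℝ) * ∑ i ∈ S, w i ^ 2) • Matrix.vecMulVec (1 : B → ℝ) 1
  have hH : ∀ B kf i j, |H B kf i j| ≤ 2 * S.card * C := fun B kf i j => by
    simpa [H] using abs_gramianSub_sub_le (S := S) hA.stochastic hw hw0 he hC B kf i j
  have hQH : ∀ (B : Finset (Fin n)) (kf : ℕ), gramianSub A S B kf =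
      ((kf : ℝ) * ∑ i ∈ S, w i ^ 2) • Matrix.vecMulVec (1 : B → ℝ) (1 : B → ℝ) + H B kf :=
    fun B kf => by simp [H]
  refine ⟨w, ⟨hw, hw0, fun w' hw' => hw'.eq_of_sum_abs_pow_sub_le he hC⟩, fun B hB => ?_,
    fun T hT => ?_⟩
  · have : Nonempty B := hB.to_subtype
    obtain ⟨lam, c, hdom, -, hbound, -, hc, hev, hspan⟩ :=
      exists_dominant_eigenpairs hσ (fun kf => gramianSub_posSemidef kf) (hH B) (hQH B)
    refine ⟨⟨H B, ⟨_, hH B⟩, hQH B⟩, lam,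
      fun kf => lam kf - Fintype.card B * (kf * ∑ i ∈ S, w i ^ 2), c, hdom, fun kf => ?_,
      ⟨_, hbound⟩, hc, hev, hspan⟩
    rw [Fintype.card_coe]
    ring
  · have : Nonempty T := hT.to_subtype
    obtain ⟨lam, c, hdom, hq, -, htend, hc, hev, hspan⟩ :=
      exists_dominant_eigenpairs hσ (fun kf => gramianSub_posSemidef kf) (hH T) (hQH T)
    have hp : 0 < (T.card : ℝ) := by exact_mod_cast hT.card_pos
    -- `EHat` is the exact discrepancy between two reciprocals. Both tend to `0`, so no rate is
    -- needed, and `1 / 0 = 0` at `kf = 0` does no harm.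
    refine ⟨fun kf h y => h.exists_isTargetControlEnergy y,
      ⟨fun kf => 1 / lam kf - 1 / ((T.card : ℝ) * kf * ∑ i ∈ S, w i ^ 2), ?_, fun kf h => ?_⟩,
      c, hc, fun kf h => ?_, ?_⟩
    · have h1 : Tendsto (fun kf : ℕ => (T.card : ℝ) * kf * ∑ i ∈ S, w i ^ 2) atTop atTop :=
        (tendsto_natCast_atTop_atTop.const_mul_atTop hp).atTop_mul_const hσ
      simpa using (htend.const_div_atTop 1).sub (h1.const_div_atTop 1)
    · rw [add_sub_cancel]
      exact h.isTargetSecurity (hdom kf).1.1 (hq kf)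
    · rw [h.isMinimallySecureGoal_iff (hdom kf).1.1 (hq kf)]
      have hv := hasEigenvector_toLin'_iff.1 (hev kf)
      refine ⟨unitize_dotProduct_self hv.2, ?_⟩
      rw [unitize, Matrix.mulVec_smul, hv.1, smul_comm]
    · filter_upwards [hspan] with kf hkf h y hy
      rw [h.isMinimallySecureGoal_iff (hdom kf).1.1 (hq kf)] at hy
      refine eq_unitize_or_eq_neg_unitize (hev kf).2 ?_ hy.1
      rw [← hkf, Module.End.mem_eigenspace_iff, Matrix.toLin'_apply]
      exact hy.2
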